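/- **Spaces and categories.** A topological space is locally connected if each of its points has a neighbourhood basis of connected sets, and locally Hausdorff if it is covered by open subsets that are Hausdorff in the subspace topology. In a locally connected space $X$, an open subset $V$ is Z-dense if $V\cap K$ is non-empty and connected for every non-empty connected open $K\subseteq X$; a subset is negligible in $X$ if its complement is Z-dense. For an arbitrary space $X$, a pair $(U,I)$ with $U\subseteq X$ open and $I\subseteq U$ is a negligible subset element if $U$, with the subspace topology, is locally connected and $I$ is negligible in $U$. A continuous map $f:X\to Y$ of locally connected spaces is diffuse if $(f^{-1}U,f^{-1}I)$ is a negligible subset element of $X$ for every negligible subset element $(U,I)$ of $Y$. Let $\mathbf{Gen}$ be the category of locally connected topological spaces and diffuse continuous maps, and let $\mathbf{HGen}^+$ be its full subcategory of locally Hausdorff spaces. **Terms.** Let $\mathcal C$ be $\mathbf{Gen}$ or $\mathbf{HGen}^+$. All morphisms, fibred products and coequalizers below are taken in $\mathcal C$. A morphism $f$ *overlays* if its self-product (kernel pair) exists and $f$ is the coequalizer of the two projections; $f$ *overlays absolutely* if its pullback along every morphism into its codomain exists and every such pullback overlays. Let $b:B\to A$ be a morphism. - $b$ is *c-open* if for every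 open embedding $u:U\to B$ there are an open embedding $w:W\to A$ and a morphism $f:U\to W$ that overlays absolutely with $b\circ u=w\circ f$. - $b$ is *c-discrete* if, whenever $Y$ is non-empty and connected, $f,g:Y\to B$ satisfy $b\circ f=b\circ g$, and $f\circ d=g\circ d$ for some morphism $d:D\to Y$ with $D\neq\emptyset$, then $f=g$. - $b$ is *c-finite* if there is $n\in\mathbb N$ such that for every non-empty connected $Y$ and every morphism $a:Y\to A$ there are at most $n$ morphisms $f:Y\to B$ with $b\circ f=a$. **Corollary.** Let $\mathcal C$ be $\mathbf{Gen}$ or $\mathbf{HGen}^+$. Let $b:B\to A$ be a c-finite, c-discrete, c-open morphism of $\mathcal C$, let $c:C\to A$ be any morphism of $\mathcal C$, and let $(P;p,q)$ be a fibred product $c\times_A b$ in $\mathcal C$, with projections $p:P\to C$ and $q:P\to B$. Then for all points $y\in C$ and $x\in B$ with $c(y)=b(x)$ there is a point $z\in P$ with $p(z)=y$ and $q(z)=x$. -/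

import Mathlib

open CategoryTheory CategoryTheory.Limits

universe v u

section PointSet

variable {X Y : Type*} [TopologicalSpace X] [TopologicalSpace Y]

/-- An open set `U` is Z-dense if it meets every non-empty connected open set in a
non-empty connected set (`IsConnected` includes non-emptiness). -/
def IsZDense (U : Set X) : Prop :=
  IsOpen U ∧ ∀ C : Set X, IsOpen C → IsConnected C → IsConnected (U ∩ C)

/-- A set is negligible if its complement is Z-dense. -/
def IsNegligible (I : Set X) : Prop := IsZDense Iᶜ

/-- The pair `(U, I)` is a negligible subset element of `X`: `U` is open in `X`, `I ⊆ U`, and in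
the subspace topology `U` is locally connected and `I` is negligible in `U`. -/
structure IsNegligibleElement (U I : Set X) : Prop where
  isOpen : IsOpen U
  subset : I ⊆ U
  locallyConnected : LocallyConnectedSpace U
  negligible : IsNegligible ((↑) ⁻¹' I : Set U)

/-- A continuous function is diffuse if it pulls back negligible subset elements to negligible
subset elements. -/
structure IsDiffuse (f : X → Y) : Prop where
  continuous : Continuous f
  preimage : ∀ U I : Set Y, IsNegligibleElement U I → IsNegligibleElement (f ⁻¹' U) (f ⁻¹' I)

/-- A space is locally Hausdorff if it is covered by open subsets that are Hausdorff in the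
subspace topology. -/
def IsLocallyHausdorff (X : Type*) [TopologicalSpace X] : Prop :=
  ∀ x : X, ∃ U : Set X, IsOpen U ∧ x ∈ U ∧ T2Space U

end PointSet

/-- Objects of the category `Gen`: locally connected topological spaces. -/
structure Gen : Type (u + 1) where
  toTop : TopCat.{u}
  locallyConnected : LocallyConnectedSpace toTop

/-- Morphisms of `Gen`: diffuse continuous functions. -/
@[ext]
structure Gen.Hom (X Y : Gen.{u}) : Type u where
  hom : X.toTop ⟶ Y.toTop
  diffuse : IsDiffuse hom

instance Gen.category : Category.{u} Gen.{u} where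
  Hom := Gen.Hom
  id X := ⟨𝟙 X.toTop, continuous_id, fun _ _ h => h⟩
  comp f g := ⟨f.hom ≫ g.hom, g.diffuse.continuous.comp f.diffuse.continuous,
    fun U I h => f.diffuse.preimage _ _ (g.diffuse.preimage U I h)⟩

/-- The underlying topological space of an object of `Gen`. -/
def Gen.space : Gen.{u} ⥤ TopCat.{u} where
  obj X := X.toTop
  map f := f.hom

/-- The category `HGen⁺`: the full subcategory of `Gen` of the locally Hausdorff spaces. -/
abbrev HGenPlus : Type (u + 1) :=
  ObjectProperty.FullSubcategory (fun X : Gen.{u} => IsLocallyHausdorff X.toTop)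

/-- The underlying topological space of an object of `HGen⁺`. -/
def HGenPlus.space : HGenPlus.{u} ⥤ TopCat.{u} :=
  ObjectProperty.ι (fun X : Gen.{u} => IsLocallyHausdorff X.toTop) ⋙ Gen.space

section Categorical

variable {𝒞 : Type u} [Category.{v} 𝒞]

/-- `b` overlays: `b` has a self-product `B ×_A B` (kernel pair), and `b` is the coequalizer of its
two projections, that is, the colimit of the canopy of `{b}`. -/
def Overlays {B A : 𝒞} (b : B ⟶ A) : Prop :=
  ∃ (R : 𝒞) (r₁ r₂ : R ⟶ B) (h : IsKernelPair b r₁ r₂),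
    Nonempty (IsColimit (Cofork.ofπ b h.w))

/-- `b` overlays absolutely: `b` can be pulled back along every morphism into its codomain, and
every pullback of `b` overlays. -/
def OverlaysAbsolutely {B A : 𝒞} (b : B ⟶ A) : Prop :=
  (∀ (C : 𝒞) (c : C ⟶ A), HasPullback c b) ∧
  ∀ (C P : 𝒞) (c : C ⟶ A) (p : P ⟶ C) (q : P ⟶ B), IsPullback p q c b → Overlays p

end Categorical

section CTerms

/-! In the following, `𝒞` is a category of topological spaces with underlying-space functor `F`;
all morphisms, products and colimits are those of `𝒞`. -/

variable {𝒞 : Type u} [Category.{v} 𝒞] (F : 𝒞 ⥤ TopCat.{v})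

/-- The formal subsets: morphisms that are open embeddings of the underlying spaces. -/
def IsFormalSubset {U X : 𝒞} (i : U ⟶ X) : Prop := Topology.IsOpenEmbedding (F.map i)

/-- `b : B ⟶ A` is c-open: the restriction of `b` to every formal subset of `B` factors as a
morphism that overlays absolutely followed by a formal subset of `A`. -/
def COpen {B A : 𝒞} (b : B ⟶ A) : Prop :=
  ∀ (U : 𝒞) (i : U ⟶ B), IsFormalSubset F i →
    ∃ (W : 𝒞) (w : W ⟶ A) (f : U ⟶ W),
      IsFormalSubset F w ∧ OverlaysAbsolutely f ∧ f ≫ w = i ≫ b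

/-- `b : B ⟶ A` is c-discrete: two morphisms over `A` from a connected object to `B` that are
equalized by a morphism with non-empty domain are equal. -/
def CDiscrete {B A : 𝒞} (b : B ⟶ A) : Prop :=
  ∀ (Y : 𝒞) (f g : Y ⟶ B), ConnectedSpace (F.obj Y) → f ≫ b = g ≫ b →
    (∃ (D : 𝒞) (d : D ⟶ Y), Nonempty (F.obj D) ∧ d ≫ f = d ≫ g) → f = g

/-- `b : B ⟶ A` is finite of order `n`: for every morphism `c : Y ⟶ A` from a non-empty connected
object there are at most `n` morphisms over `A` from `Y` to `B`. -/
def CFiniteOfOrder {B A : 𝒞} (b : B ⟶ A) (n : ℕ) : Prop :=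
  ∀ (Y : 𝒞) (c : Y ⟶ A), ConnectedSpace (F.obj Y) → {f : Y ⟶ B | f ≫ b = c}.encard ≤ n

/-- `b` is c-finite: it is finite of some order. -/
def CFinite {B A : 𝒞} (b : B ⟶ A) : Prop := ∃ n : ℕ, CFiniteOfOrder F b n

end CTerms

/-! Among connected pointed objects `(Y, y₀)` over `(C, y)`, choose one with the greatest number of
lifts `Y ⟶ B` of the composite to `A`; c-finiteness bounds this number. By c-discreteness,
restricting lifts along a connected `(Z, z)` over `(Y, y₀)` is injective, so by maximality every
lift on `Z` comes from `Y`. By c-openness, every neighbourhood of `x` contains the value at `z` of a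
lift on some such `Z`, hence the value at `y₀` of one of the finitely many lifts on `Y`. Therefore a
single lift `s` satisfies `s y₀ ⤳ x`.

It remains to replace `s y₀` by `x`. Locally Hausdorff spaces are T1, so there the two are equal. In
`Gen`, a closed specialization of `y₀` is adjoined to `Y` and sent to `x` in `B` and to `y` in `C`.
The universal property of `P` then supplies the point.

c-openness yields actual points because epimorphisms are surjective: in `Gen` by testing against an
indiscrete thickening of the codomain, in `HGen⁺` by doubling a missed point. -/

open Topology

/-! ### Diffuse maps and negligible subset elements -/

section Diffuse

variable {X Y Z : Type*} [TopologicalSpace X] [TopologicalSpace Y] [TopologicalSpace Z]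

/-- Eliminates the subspace topology: every condition except local connectedness of `U` is expressed
by subsets of `X`. -/
theorem isNegligibleElement_iff {U I : Set X} :
    IsNegligibleElement U I ↔ IsOpen U ∧ I ⊆ U ∧ LocallyConnectedSpace U ∧ IsOpen (U \ I) ∧
      ∀ K ⊆ U, IsOpen K → IsConnected K → IsConnected (K \ I) := by
  have key : ∀ s : Set U, ((↑) '' (((↑) ⁻¹' I)ᶜ ∩ s) : Set X) = (↑) '' s \ I := by
    intro s
    ext x
    constructor
    · rintro ⟨z, ⟨h1, h2⟩, rfl⟩
      exact ⟨⟨z, h2, rfl⟩, h1⟩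
    · rintro ⟨⟨z, h2, rfl⟩, h1⟩
      exact ⟨z, ⟨h1, h2⟩, rfl⟩
  have conn : ∀ s : Set U, IsConnected s ↔ IsConnected ((↑) '' s : Set X) := fun s => by
    simp only [_root_.IsConnected, Set.image_nonempty, IsInducing.subtypeVal.isPreconnected_image]
  constructor
  · rintro ⟨hU, hI, hl, ho, hc⟩
    refine ⟨hU, hI, hl, ?_, fun K hK hKo hKc => ?_⟩
    · have := hU.isOpenMap_subtype_val _ ho
      have h := key Set.univ
      rw [Set.inter_univ, Set.image_univ, Subtype.range_coe] at h
      rwa [← h]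
    · have hK' : ((↑) '' ((↑) ⁻¹' K : Set U) : Set X) = K := by
        rw [Set.image_preimage_eq_inter_range, Subtype.range_coe, Set.inter_eq_left.2 hK]
      have := hc ((↑) ⁻¹' K) (hKo.preimage continuous_subtype_val) ((conn _).2 (by rwa [hK']))
      rwa [conn, key, hK'] at this
  · rintro ⟨hU, hI, hl, ho, hc⟩
    refine ⟨hU, hI, hl, ?_, fun K hKo hKc => ?_⟩
    · convert ho.preimage (continuous_subtype_val (p := (· ∈ U))) using 1
      ext z
      simp
    · rw [conn, key]
      exact hc _ (by simp) (hU.isOpenMap_subtype_val _ hKo) ((conn _).1 hKc)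

theorem isDiffuse_of_forall [LocallyConnectedSpace X] {f : X → Y} (hf : Continuous f)
    (h : ∀ V I : Set Y, IsNegligibleElement V I → ∀ K ⊆ f ⁻¹' V, IsOpen K → IsConnected K →
      IsConnected (K \ f ⁻¹' I)) : IsDiffuse f := by
  refine ⟨hf, fun V I hVI => isNegligibleElement_iff.2 ?_⟩
  obtain ⟨hV, hI, -, ho, -⟩ := isNegligibleElement_iff.1 hVI
  exact ⟨hV.preimage hf, Set.preimage_mono hI,
    (hV.preimage hf).isOpenEmbedding_subtypeVal.locallyConnectedSpace,
    ho.preimage hf, h V I hVI⟩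

theorem IsNegligibleElement.isConnected_diff {U I K : Set X} (h : IsNegligibleElement U I)
    (hK : K ⊆ U) (hKo : IsOpen K) (hKc : IsConnected K) : IsConnected (K \ I) :=
  (isNegligibleElement_iff.1 h).2.2.2.2 K hK hKo hKc

theorem IsNegligibleElement.isOpen_diff {U I : Set X} (h : IsNegligibleElement U I) :
    IsOpen (U \ I) :=
  (isNegligibleElement_iff.1 h).2.2.2.1

theorem IsDiffuse.isConnected_diff {f : X → Y} (hf : IsDiffuse f) {V I : Set Y}
    (h : IsNegligibleElement V I) {K : Set X} (hK : K ⊆ f ⁻¹' V) (hKo : IsOpen K)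
    (hKc : IsConnected K) : IsConnected (K \ f ⁻¹' I) :=
  (hf.preimage V I h).isConnected_diff hK hKo hKc

theorem Topology.IsInducing.isConnected_image {f : X → Y} (hf : IsInducing f) {s : Set X} :
    IsConnected (f '' s) ↔ IsConnected s := by
  simp only [_root_.IsConnected, Set.image_nonempty, hf.isPreconnected_image]

theorem Topology.IsOpenEmbedding.isDiffuse [LocallyConnectedSpace X] {f : X → Y}
    (hf : IsOpenEmbedding f) : IsDiffuse f := by
  refine isDiffuse_of_forall hf.continuous fun V I hVI K hK hKo hKc => ?_
  have := hVI.isConnected_diff (Set.image_subset_iff.2 hK) (hf.isOpenMap _ hKo)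
    (hKc.image f hf.continuous.continuousOn)
  rwa [← Set.image_sdiff_preimage, hf.isInducing.isConnected_image] at this

theorem IsNegligibleElement.image [LocallyConnectedSpace Y] {f : X → Y} (hf : IsOpenEmbedding f)
    {U I : Set X} (h : IsNegligibleElement U I) : IsNegligibleElement (f '' U) (f '' I) := by
  refine isNegligibleElement_iff.2 ⟨hf.isOpenMap _ h.isOpen, Set.image_mono h.subset,
    (hf.isOpenMap _ h.isOpen).isOpenEmbedding_subtypeVal.locallyConnectedSpace, ?_, ?_⟩
  · rw [← Set.image_sdiff hf.injective]
    exact hf.isOpenMap _ h.isOpen_diff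
  · intro K hK hKo hKc
    obtain ⟨K, hKU, rfl⟩ := Set.subset_image_iff.1 hK
    rw [← Set.image_sdiff hf.injective, hf.isInducing.isConnected_image]
    exact h.isConnected_diff hKU (hf.isOpen_iff_image_isOpen.2 hKo)
      (hf.isInducing.isConnected_image.1 hKc)

theorem IsDiffuse.of_comp_isOpenEmbedding [LocallyConnectedSpace Z] {g : Y → Z} {f : X → Y}
    (hg : IsOpenEmbedding g) (h : IsDiffuse (g ∘ f)) : IsDiffuse f := by
  refine ⟨hg.isInducing.continuous_iff.2 h.continuous, fun V I hVI => ?_⟩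
  have := h.preimage _ _ (hVI.image hg)
  rwa [Set.preimage_comp, Set.preimage_comp, Set.preimage_image_eq _ hg.injective,
    Set.preimage_image_eq _ hg.injective] at this

/-- A section of an inducing map is diffuse. -/
theorem IsDiffuse.of_leftInverse_isInducing [LocallyConnectedSpace X] {r : Y → X} {s : X → Y}
    (hr : IsInducing r) (hs : Function.LeftInverse r s) : IsDiffuse s := by
  have hsc : Continuous s := hr.continuous_iff.2 (by
    rw [show r ∘ s = id from funext hs]; exact continuous_id)
  refine isDiffuse_of_forall hsc fun V I hVI K hK hKo hKc => ?_
  have him : r '' (r ⁻¹' K) = K := Set.image_preimage_eq K hs.surjective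
  -- `s (r t)` and `t` have the same image under the inducing map `r`, so no open set separates
  -- them.
  have hmem : ∀ O : Set Y, IsOpen O → ∀ t, s (r t) ∈ O ↔ t ∈ O := fun O hO t =>
    (hr.inseparable_iff.1 (show Inseparable (r (s (r t))) (r t) by rw [hs])).mem_open_iff hO
  have h1 := hVI.isConnected_diff (K := r ⁻¹' K) (fun t ht => (hmem V hVI.isOpen t).1 (hK ht))
    (hKo.preimage hr.continuous) (hr.isConnected_image.1 (by rwa [him]))
  convert h1.image r hr.continuous.continuousOn using 1
  ext k
  constructor
  · rintro ⟨hk, hI⟩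
    exact ⟨s k, ⟨by simpa [hs k] using hk, hI⟩, hs k⟩
  · rintro ⟨t, ⟨ht, hI⟩, rfl⟩
    exact ⟨ht, ((hmem _ hVI.isOpen_diff t).2 ⟨(hmem V hVI.isOpen t).1 (hK ht), hI⟩).2⟩

theorem Topology.IsInducing.locallyConnectedSpace_of_surjective [LocallyConnectedSpace X]
    {r : Y → X} (hr : IsInducing r) (hs : Function.Surjective r) : LocallyConnectedSpace Y := by
  rw [locallyConnectedSpace_iff_subsets_isOpen_isConnected]
  intro y U hU
  rw [hr.nhds_eq_comap] at hU
  obtain ⟨V, hV, hVU⟩ := hU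
  obtain ⟨W, hWV, hWo, hyW, hWc⟩ :=
    locallyConnectedSpace_iff_subsets_isOpen_isConnected.1 ‹_› (r y) V hV
  refine ⟨r ⁻¹' W, (Set.preimage_mono hWV).trans hVU, hWo.preimage hr.continuous, hyW, ?_⟩
  rwa [← hr.isConnected_image, Set.image_preimage_eq _ hs]

end Diffuse

/-! ### Adjoining a closed specialization of a point -/

/-- The space `X` with one more point `none`, whose open neighbourhoods are the open sets that
contain `x₀`. -/
def AddSpecialization {X : Type*} (_ : X) : Type _ := Option X

namespace AddSpecialization

variable {X Y : Type*} {x₀ : X}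

variable (x₀) in
/-- The inclusion of the space. -/
def incl (x : X) : AddSpecialization x₀ := some x

variable (x₀) in
/-- The additional point. -/
def pt : AddSpecialization x₀ := none

theorem incl_injective : Function.Injective (incl x₀) := Option.some_injective X

theorem cases (z : AddSpecialization x₀) : z = pt x₀ ∨ ∃ x, z = incl x₀ x := by
  rcases z with _ | x
  exacts [Or.inl rfl, Or.inr ⟨x, rfl⟩]

variable (x₀) in
/-- The extension of a function by a value at the additional point. -/
def extend (f : X → Y) (y : Y) (z : AddSpecialization x₀) : Y := Option.elim z y f

variable [TopologicalSpace X] [TopologicalSpace Y]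

instance : TopologicalSpace (AddSpecialization x₀) where
  IsOpen U := IsOpen (some ⁻¹' U : Set X) ∧ ((none : Option X) ∈ U → some x₀ ∈ U)
  isOpen_univ := ⟨isOpen_univ, fun _ => trivial⟩
  isOpen_inter U V hU hV := ⟨hU.1.inter hV.1, fun h => ⟨hU.2 h.1, hV.2 h.2⟩⟩
  isOpen_sUnion S hS := by
    refine ⟨?_, ?_⟩
    · exact Set.preimage_sUnion (f := (some : X → Option X)) ▸
        isOpen_biUnion fun U hU => (hS U hU).1
    · rintro ⟨U, hU, h⟩
      exact ⟨U, hU, (hS U hU).2 h⟩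

theorem isOpen_iff {U : Set (AddSpecialization x₀)} :
    IsOpen U ↔ IsOpen (incl x₀ ⁻¹' U) ∧ (pt x₀ ∈ U → incl x₀ x₀ ∈ U) := Iff.rfl

theorem continuous_incl : Continuous (incl x₀) := ⟨fun _ h => h.1⟩

theorem continuous_extend {f : X → Y} (hf : Continuous f) {y : Y} (hy : f x₀ ⤳ y) :
    Continuous (extend x₀ f y) :=
  ⟨fun _ hO => isOpen_iff.2 ⟨hO.preimage hf, hy.mem_open hO⟩⟩

theorem specializes : incl x₀ x₀ ⤳ pt x₀ :=
  specializes_iff_forall_open.2 fun _ hU => (isOpen_iff.1 hU).2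

/-- The additional point lies in the closure of `incl x₀ x₀`, so `K` lies between a connected set
and its closure. -/
theorem isConnected_of_preimage {K : Set (AddSpecialization x₀)}
    (hK : IsConnected (incl x₀ ⁻¹' K)) (h : pt x₀ ∈ K → incl x₀ x₀ ∈ K) : IsConnected K := by
  refine (hK.image _ continuous_incl.continuousOn).subset_closure
    (Set.image_preimage_subset _ _) fun z hz => ?_
  rcases cases z with rfl | ⟨x, rfl⟩
  · exact (specializes.mem_closed isClosed_closure) (subset_closure ⟨x₀, h hz, rfl⟩)
  · exact subset_closure ⟨x, hz, rfl⟩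

/-- The retraction that sends the additional point to `x₀` is continuous, and it maps an open `K`
onto its trace on `X`. -/
theorem isConnected_preimage {K : Set (AddSpecialization x₀)} (hKo : IsOpen K)
    (hK : IsConnected K) : IsConnected (incl x₀ ⁻¹' K) := by
  convert hK.image (extend x₀ id x₀) (continuous_extend continuous_id specializes_rfl).continuousOn
    using 1
  ext x
  constructor
  · exact fun hx => ⟨incl x₀ x, hx, rfl⟩
  · rintro ⟨z, hz, rfl⟩
    rcases cases z with rfl | ⟨x, rfl⟩
    exacts [(isOpen_iff.1 hKo).2 hz, hz]

instance [LocallyConnectedSpace X] : LocallyConnectedSpace (AddSpecialization x₀) := by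
  have H := locallyConnectedSpace_iff_subsets_isOpen_isConnected.1 ‹LocallyConnectedSpace X›
  rw [locallyConnectedSpace_iff_subsets_isOpen_isConnected]
  intro z U hU
  obtain ⟨O, hOU, hO, hz⟩ := mem_nhds_iff.1 hU
  rcases cases z with rfl | ⟨x, rfl⟩
  · obtain ⟨V, hVO, hV, hx, hVc⟩ := H x₀ (incl x₀ ⁻¹' O)
      ((hO.preimage continuous_incl).mem_nhds ((isOpen_iff.1 hO).2 hz))
    have hpre : incl x₀ ⁻¹' (insert (pt x₀) (incl x₀ '' V)) = V := by
      ext x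
      constructor
      · rintro (h | ⟨x', hx', h⟩)
        · cases h
        · cases h; exact hx'
      · exact fun h => Or.inr ⟨x, h, rfl⟩
    refine ⟨insert (pt x₀) (incl x₀ '' V), ?_, isOpen_iff.2 ⟨by rwa [hpre], fun _ =>
      Or.inr ⟨x₀, hx, rfl⟩⟩, Or.inl rfl, isConnected_of_preimage (by rwa [hpre]) fun _ =>
      Or.inr ⟨x₀, hx, rfl⟩⟩
    exact Set.insert_subset (hOU hz) ((Set.image_subset_iff.2 hVO).trans hOU)
  · obtain ⟨V, hVO, hV, hx, hVc⟩ := H x (incl x₀ ⁻¹' O)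
      ((hO.preimage continuous_incl).mem_nhds hz)
    refine ⟨incl x₀ '' V, (Set.image_subset_iff.2 hVO).trans hOU, isOpen_iff.2 ⟨?_, ?_⟩,
      ⟨x, hx, rfl⟩, hVc.image _ continuous_incl.continuousOn⟩
    · rwa [Set.preimage_image_eq _ incl_injective]
    · rintro ⟨x', -, h⟩
      cases h

theorem isDiffuse_extend [LocallyConnectedSpace X] {f : X → Y} (hf : IsDiffuse f) {y : Y}
    (hy : f x₀ ⤳ y) : IsDiffuse (extend x₀ f y) := by
  refine isDiffuse_of_forall (continuous_extend hf.continuous hy) fun V I hVI K hK hKo hKc => ?_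
  refine isConnected_of_preimage (hf.isConnected_diff hVI (fun x hx => hK hx)
    (hKo.preimage continuous_incl) (isConnected_preimage hKo hKc)) fun h => ?_
  -- `V \ I` is open and contains `y`, so it also contains the generization `f x₀`.
  exact ⟨(isOpen_iff.1 hKo).2 h.1, (hy.mem_open hVI.isOpen_diff ⟨hK h.1, h.2⟩).2⟩

end AddSpecialization

/-! ### Doubling a point -/

/-- The space `X` with the point `x₀` doubled. -/
def DoublePoint {X : Type*} (_ : X) : Type _ := Option X

namespace DoublePoint

variable {X : Type*} {x₀ : X}

variable (x₀) in
/-- The first copy of the space. -/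
def inl (x : X) : DoublePoint x₀ := some x

open Classical in
variable (x₀) in
/-- The second copy of the space. -/
noncomputable def inr (x : X) : DoublePoint x₀ := if x = x₀ then none else some x

theorem inr_self : inr x₀ x₀ = none := if_pos rfl

theorem inr_of_ne {x : X} (h : x ≠ x₀) : inr x₀ x = inl x₀ x := if_neg h

theorem inl_injective : Function.Injective (inl x₀) := Option.some_injective X

theorem inr_injective : Function.Injective (inr x₀) := by
  intro x y h
  by_cases hx : x = x₀ <;> by_cases hy : y = x₀
  · exact hx.trans hy.symm
  · rw [hx, inr_self, inr_of_ne hy] at h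
    exact (Option.some_ne_none y h.symm).elim
  · rw [hy, inr_self, inr_of_ne hx] at h
    exact (Option.some_ne_none x h).elim
  · rw [inr_of_ne hx, inr_of_ne hy] at h
    exact inl_injective h

theorem inl_eq_inr {x y : X} : inl x₀ x = inr x₀ y ↔ x = y ∧ x ≠ x₀ := by
  by_cases hy : y = x₀
  · subst hy
    rw [inr_self]
    exact ⟨fun h => (Option.some_ne_none _ h).elim, fun h => (h.2 h.1).elim⟩
  · rw [inr_of_ne hy, inl_injective.eq_iff]
    exact ⟨fun h => ⟨h, h ▸ hy⟩, fun h => h.1⟩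

theorem exists_rep (z : DoublePoint x₀) : (∃ x, inl x₀ x = z) ∨ ∃ x, inr x₀ x = z := by
  rcases z with _ | x
  exacts [Or.inr ⟨x₀, inr_self⟩, Or.inl ⟨x, rfl⟩]

variable [TopologicalSpace X]

noncomputable instance : TopologicalSpace (DoublePoint x₀) :=
  .coinduced (inl x₀) ‹_› ⊔ .coinduced (inr x₀) ‹_›

theorem isOpen_iff {U : Set (DoublePoint x₀)} :
    IsOpen U ↔ IsOpen (inl x₀ ⁻¹' U) ∧ IsOpen (inr x₀ ⁻¹' U) := Iff.rfl

variable [T1Space X]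

/-- An open `O` in one copy meets the other copy in `O \ {x₀}`, which is open because points are
closed. -/
theorem isOpenEmbedding_inl : IsOpenEmbedding (inl x₀) := by
  refine .of_continuous_injective_isOpenMap ⟨fun _ h => (isOpen_iff.1 h).1⟩ inl_injective
    fun O hO => isOpen_iff.2 ⟨by rwa [Set.preimage_image_eq _ inl_injective], ?_⟩
  convert hO.sdiff (isClosed_singleton (x := x₀)) using 1
  ext x
  simp only [Set.mem_preimage, Set.mem_image, inl_eq_inr, Set.mem_sdiff, Set.mem_singleton_iff]
  exact ⟨fun ⟨y, hy, h, h'⟩ => h ▸ ⟨hy, h'⟩, fun h => ⟨x, h.1, rfl, h.2⟩⟩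

theorem isOpenEmbedding_inr : IsOpenEmbedding (inr x₀) := by
  refine .of_continuous_injective_isOpenMap ⟨fun _ h => (isOpen_iff.1 h).2⟩ inr_injective
    fun O hO => isOpen_iff.2 ⟨?_, by rwa [Set.preimage_image_eq _ inr_injective]⟩
  convert hO.sdiff (isClosed_singleton (x := x₀)) using 1
  ext x
  simp only [Set.mem_preimage, Set.mem_image, eq_comm (b := inl x₀ x), inl_eq_inr, Set.mem_sdiff,
    Set.mem_singleton_iff]
  exact ⟨fun ⟨y, hy, h, h'⟩ => ⟨h ▸ hy, h'⟩, fun h => ⟨x, h.1, rfl, h.2⟩⟩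

instance [LocallyConnectedSpace X] : LocallyConnectedSpace (DoublePoint x₀) := by
  rw [locallyConnectedSpace_iff_subsets_isOpen_isConnected]
  have key : ∀ (s : X → DoublePoint x₀), IsOpenEmbedding s → ∀ x, ∀ U ∈ 𝓝 (s x),
      ∃ V ⊆ U, IsOpen V ∧ s x ∈ V ∧ IsConnected V := by
    intro s hs x U hU
    obtain ⟨V, hVU, hVo, hx, hVc⟩ := locallyConnectedSpace_iff_subsets_isOpen_isConnected.1 ‹_› x
      (s ⁻¹' U) (hs.continuous.continuousAt hU)
    exact ⟨s '' V, Set.image_subset_iff.2 hVU, hs.isOpenMap _ hVo, ⟨x, hx, rfl⟩,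
      hVc.image s hs.continuous.continuousOn⟩
  intro z
  rcases exists_rep z with ⟨x, rfl⟩ | ⟨x, rfl⟩
  exacts [key _ isOpenEmbedding_inl x, key _ isOpenEmbedding_inr x]

end DoublePoint

/-! ### Locally Hausdorff spaces -/

section LocallyHausdorff

variable {X Y : Type*} [TopologicalSpace X] [TopologicalSpace Y]

theorem IsLocallyHausdorff.t1Space (h : IsLocallyHausdorff X) : T1Space X := by
  rw [t1Space_iff_exists_open]
  intro x y hxy
  obtain ⟨U, hU, hx, hT⟩ := h x
  by_cases hy : y ∈ U
  · obtain ⟨O, O', hO, -, hxO, hyO, hd⟩ :=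
      t2_separation (x := (⟨x, hx⟩ : U)) (y := ⟨y, hy⟩) (by simpa using hxy)
    refine ⟨(↑) '' O, hU.isOpenMap_subtype_val _ hO, ⟨_, hxO, rfl⟩, ?_⟩
    rintro ⟨z, hz, rfl⟩
    exact Set.disjoint_left.1 hd hz hyO
  · exact ⟨U, hU, hx, hy⟩

theorem IsLocallyHausdorff.of_injective (h : IsLocallyHausdorff Y) {f : X → Y} (hf : Continuous f)
    (hi : Function.Injective f) : IsLocallyHausdorff X := by
  intro x
  obtain ⟨U, hU, hx, hT⟩ := h (f x)
  refine ⟨f ⁻¹' U, hU.preimage hf, hx, ?_⟩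
  refine T2Space.of_injective_continuous (f := U.restrictPreimage f) ?_ (hf.restrictPreimage)
  exact U.restrictPreimage_injective hi

theorem IsLocallyHausdorff.doublePoint (h : IsLocallyHausdorff X) (x₀ : X) :
    IsLocallyHausdorff (DoublePoint x₀) := by
  have := h.t1Space
  have key : ∀ (s : X → DoublePoint x₀), IsOpenEmbedding s → ∀ x,
      ∃ U : Set (DoublePoint x₀), IsOpen U ∧ s x ∈ U ∧ T2Space U := by
    intro s hs x
    obtain ⟨U, hU, hx, hT⟩ := h x
    exact ⟨s '' U, hs.isOpenMap _ hU, ⟨x, hx, rfl⟩,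
      (hs.toIsEmbedding.homeomorphImage U).t2Space⟩
  intro z
  rcases DoublePoint.exists_rep z with ⟨x, rfl⟩ | ⟨x, rfl⟩
  exacts [key _ DoublePoint.isOpenEmbedding_inl x, key _ DoublePoint.isOpenEmbedding_inr x]

end LocallyHausdorff

instance (X : Gen.{u}) : LocallyConnectedSpace X.toTop := X.locallyConnected

instance (X : Gen.{u}) : LocallyConnectedSpace (Gen.space.obj X) := X.locallyConnected

namespace Gen

/-- The object of `Gen` given by a locally connected space. -/
def of (X : Type u) [TopologicalSpace X] [LocallyConnectedSpace X] : Gen.{u} :=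
  ⟨TopCat.of X, ‹_›⟩

/-- The morphism of `Gen` given by a diffuse function. -/
def ofHom {X Y : Gen.{u}} (f : X.toTop → Y.toTop) (hf : IsDiffuse f) : X ⟶ Y :=
  Gen.Hom.mk (TopCat.ofHom ⟨f, hf.continuous⟩) hf

theorem hom_ext {X Y : Gen.{u}} {f g : X ⟶ Y}
    (h : ∀ x, Gen.space.map f x = Gen.space.map g x) : f = g :=
  Gen.Hom.ext (ConcreteCategory.hom_ext (f.hom) (g.hom) h)

theorem isDiffuse_map {X Y : Gen.{u}} (f : X ⟶ Y) : IsDiffuse (Gen.space.map f) := f.diffuse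

theorem exists_lift {X Y Z : Gen.{u}} (w : Y ⟶ Z) (hw : IsOpenEmbedding (Gen.space.map w))
    (h : X ⟶ Z) (hr : ∀ x, Gen.space.map h x ∈ Set.range (Gen.space.map w)) :
    ∃ k : X ⟶ Y, k ≫ w = h := by
  choose k hk using hr
  refine ⟨ofHom k (.of_comp_isOpenEmbedding hw ?_), hom_ext hk⟩
  exact (show Gen.space.map w ∘ k = Gen.space.map h from funext hk) ▸ isDiffuse_map h

end Gen

/-! ### The argument for any full subcategory of `Gen` with three properties -/

section Points

variable {𝒞 : Type (u + 1)} [Category.{u} 𝒞] (F : 𝒞 ⥤ Gen.{u})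

/-- Open subsets of objects carry formal subsets. -/
def HasFormalSubsets : Prop :=
  ∀ (X : 𝒞) (O : Set ((F ⋙ Gen.space).obj X)), IsOpen O →
    ∃ (U : 𝒞) (i : U ⟶ X), IsFormalSubset (F ⋙ Gen.space) i ∧
      Set.range ((F ⋙ Gen.space).map i) = O

/-- Epimorphisms are surjective. -/
def EpiSurjective : Prop :=
  ∀ (X Y : 𝒞) (f : X ⟶ Y), Epi f → Function.Surjective ((F ⋙ Gen.space).map f)

/-- Two morphisms with the same domain can be extended to a further point, with specializations of
the values at a given point as values. -/
def HasSpecializations : Prop :=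
  ∀ (Y B C : 𝒞) (s : Y ⟶ B) (t : Y ⟶ C) (y : (F ⋙ Gen.space).obj Y)
    (b : (F ⋙ Gen.space).obj B) (c : (F ⋙ Gen.space).obj C),
    (F ⋙ Gen.space).map s y ⤳ b → (F ⋙ Gen.space).map t y ⤳ c →
    ∃ (Z : 𝒞) (s' : Z ⟶ B) (t' : Z ⟶ C) (z : (F ⋙ Gen.space).obj Z),
      (F ⋙ Gen.space).map s' z = b ∧ (F ⋙ Gen.space).map t' z = c ∧
      ∀ (A : 𝒞) (f : B ⟶ A) (g : C ⟶ A), s ≫ f = t ≫ g →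
        (F ⋙ Gen.space).map f b = (F ⋙ Gen.space).map g c → s' ≫ f = t' ≫ g

variable {F}

theorem Overlays.epi {B A : 𝒞} {b : B ⟶ A} (h : Overlays b) : Epi b := by
  obtain ⟨R, r₁, r₂, h, ⟨hc⟩⟩ := h
  exact ⟨fun f g hfg => Cofork.IsColimit.hom_ext hc hfg⟩

theorem HasFormalSubsets.exists_connected (hF : HasFormalSubsets F) {X : 𝒞}
    {O : Set ((F ⋙ Gen.space).obj X)} (hO : IsOpen O) {x : (F ⋙ Gen.space).obj X} (hx : x ∈ O) :
    ∃ (U : 𝒞) (i : U ⟶ X) (y : (F ⋙ Gen.space).obj U), ConnectedSpace ((F ⋙ Gen.space).obj U) ∧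
      (F ⋙ Gen.space).map i y = x ∧ ∀ z, (F ⋙ Gen.space).map i z ∈ O := by
  obtain ⟨V, hVO, hV, hxV, hVc⟩ := locallyConnectedSpace_iff_subsets_isOpen_isConnected.1
    (F.obj X).locallyConnected x O (hO.mem_nhds hx)
  obtain ⟨U, i, hi, hr⟩ := hF X V hV
  obtain ⟨y, hy⟩ : x ∈ Set.range ((F ⋙ Gen.space).map i) := by rwa [hr]
  refine ⟨U, i, y, ?_, hy, fun z => hVO (hr ▸ Set.mem_range_self z)⟩
  rwa [connectedSpace_iff_univ, ← hi.isInducing.isConnected_image, Set.image_univ, hr]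

/-- This is where c-openness is used. The part of `b` over `O` overlays absolutely onto an open part
of `A`, so after `Y` is shrunk around `y` its pullback is an epimorphism, hence hits the point over
`y`. -/
theorem exists_lift_mem [F.Full] [F.Faithful] (hF : HasFormalSubsets F) (hE : EpiSurjective F)
    {A B Y : 𝒞} {b : B ⟶ A} (hb : COpen (F ⋙ Gen.space) b) (a : Y ⟶ A)
    (y : (F ⋙ Gen.space).obj Y) (x : (F ⋙ Gen.space).obj B)
    (hxy : (F ⋙ Gen.space).map a y = (F ⋙ Gen.space).map b x)
    {O : Set ((F ⋙ Gen.space).obj B)} (hO : IsOpen O) (hx : x ∈ O) :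
    ∃ (Z : 𝒞) (d : Z ⟶ Y) (s : Z ⟶ B) (z : (F ⋙ Gen.space).obj Z),
      ConnectedSpace ((F ⋙ Gen.space).obj Z) ∧ s ≫ b = d ≫ a ∧
      (F ⋙ Gen.space).map d z = y ∧ (F ⋙ Gen.space).map s z ∈ O := by
  obtain ⟨U, i, hi, hr⟩ := hF B O hO
  obtain ⟨W, w, f, hw, hf, hfw⟩ := hb U i hi
  obtain ⟨x', hx'⟩ : x ∈ Set.range ((F ⋙ Gen.space).map i) := by rwa [hr]
  have hyw : (F ⋙ Gen.space).map a y ∈ Set.range ((F ⋙ Gen.space).map w) := by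
    refine ⟨(F ⋙ Gen.space).map f x', ?_⟩
    rw [hxy, ← hx', ← ConcreteCategory.comp_apply, ← ConcreteCategory.comp_apply,
      ← Functor.map_comp, ← Functor.map_comp, hfw]
  obtain ⟨Y₁, j, y₁, -, hy₁, hj⟩ := hF.exists_connected
    (hw.isOpen_range.preimage ((F ⋙ Gen.space).map a).hom.continuous) hyw
  obtain ⟨k, hk⟩ := Gen.exists_lift (F.map w) hw (F.map (j ≫ a)) (fun z => by
    have := hj z
    rw [Set.mem_preimage, ← ConcreteCategory.comp_apply, ← Functor.map_comp] at this
    exact this)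
  obtain ⟨k, rfl⟩ := F.map_surjective k
  rw [← F.map_comp] at hk
  replace hk := F.map_injective hk
  have := hf.1 Y₁ k
  obtain ⟨z, hz⟩ := hE _ _ _ (hf.2 _ _ _ _ _ (IsPullback.of_hasPullback k f)).epi y₁
  obtain ⟨Z, e, z', hZ, hz', -⟩ := hF.exists_connected isOpen_univ (Set.mem_univ z)
  refine ⟨Z, e ≫ pullback.fst k f ≫ j, e ≫ pullback.snd k f ≫ i, z', hZ, ?_, ?_, ?_⟩
  · simp only [Category.assoc, ← hfw, ← hk, pullback.condition_assoc]
  · rw [Functor.map_comp, Functor.map_comp, ConcreteCategory.comp_apply,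
      ConcreteCategory.comp_apply, hz', hz, hy₁]
  · rw [← Category.assoc, Functor.map_comp, ConcreteCategory.comp_apply, ← hr]
    exact Set.mem_range_self _

/-- A connected pointed object over `(C, y)` to which every lift of a connected pointed object over
it descends. -/
theorem exists_maximal_lifts (hF : HasFormalSubsets F) {A B C : 𝒞} {b : B ⟶ A} (c : C ⟶ A)
    (hfin : CFinite (F ⋙ Gen.space) b) (hdis : CDiscrete (F ⋙ Gen.space) b)
    (y : (F ⋙ Gen.space).obj C) :
    ∃ (Y : 𝒞) (t : Y ⟶ C) (y₀ : (F ⋙ Gen.space).obj Y), (F ⋙ Gen.space).map t y₀ = y ∧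
      {s : Y ⟶ B | s ≫ b = t ≫ c}.Finite ∧
      ∀ (Z : 𝒞) (d : Z ⟶ Y) (s : Z ⟶ B) (z : (F ⋙ Gen.space).obj Z),
        ConnectedSpace ((F ⋙ Gen.space).obj Z) → s ≫ b = (d ≫ t) ≫ c →
        (F ⋙ Gen.space).map d z = y₀ → ∃ s₀ : Y ⟶ B, s₀ ≫ b = t ≫ c ∧ d ≫ s₀ = s := by
  obtain ⟨n, hn⟩ := hfin
  -- The numbers of lifts that occur; a maximal one is attained since `S` is non-empty and bounded
  -- by `n`.
  let S : Set ℕ := {m | ∃ (Y : 𝒞) (t : Y ⟶ C) (y₀ : (F ⋙ Gen.space).obj Y),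
    ConnectedSpace ((F ⋙ Gen.space).obj Y) ∧ (F ⋙ Gen.space).map t y₀ = y ∧
    {s : Y ⟶ B | s ≫ b = t ≫ c}.encard = m}
  have hlt : ∀ {Y : 𝒞} (t : Y ⟶ C), ConnectedSpace ((F ⋙ Gen.space).obj Y) →
      ∃ m : ℕ, m ≤ n ∧ {s : Y ⟶ B | s ≫ b = t ≫ c}.encard = m := fun t hY => by
    obtain ⟨m, hm⟩ := ENat.ne_top_iff_exists.1 ((hn _ (t ≫ c) hY).trans_lt (ENat.natCast_lt_top n)).ne
    exact ⟨m, by exact_mod_cast hm ▸ hn _ (t ≫ c) hY, hm.symm⟩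
  have hne : S.Nonempty := by
    obtain ⟨Y, t, y₀, hY, hy, -⟩ := hF.exists_connected isOpen_univ (Set.mem_univ y)
    obtain ⟨m, -, hm⟩ := hlt t hY
    exact ⟨m, Y, t, y₀, hY, hy, hm⟩
  have hbdd : BddAbove S := by
    refine ⟨n, ?_⟩
    rintro m ⟨Y, t, y₀, hY, -, hm⟩
    exact_mod_cast hm ▸ hn _ (t ≫ c) hY
  obtain ⟨Y, t, y₀, hY, hy, hm⟩ := Nat.sSup_mem hne hbdd
  refine ⟨Y, t, y₀, hy, Set.finite_of_encard_eq_coe hm, fun Z d s z hZ hs hz => ?_⟩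
  have hinj : Set.InjOn (fun s₀ => d ≫ s₀) {s : Y ⟶ B | s ≫ b = t ≫ c} := fun f hf g hg h =>
    hdis Y f g hY (hf.trans hg.symm) ⟨Z, d, ⟨z⟩, h⟩
  have hsub : (fun s₀ => d ≫ s₀) '' {s : Y ⟶ B | s ≫ b = t ≫ c} ⊆
      {s : Z ⟶ B | s ≫ b = (d ≫ t) ≫ c} := by
    rintro _ ⟨f, hf, rfl⟩
    simp only [Set.mem_ofPred_eq, Category.assoc] at hf ⊢
    rw [hf]
  obtain ⟨m, -, hm'⟩ := hlt (d ≫ t) hZ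
  have hmS : m ∈ S := ⟨Z, d ≫ t, z, hZ, by
    rw [Functor.map_comp, ConcreteCategory.comp_apply, hz, hy], hm'⟩
  -- Maximality for `Y`, applied to `Z` as a competitor: with injectivity of restriction, the
  -- restricted lifts already exhaust the finite set of lifts on `Z`.
  have hle : {s : Z ⟶ B | s ≫ b = (d ≫ t) ≫ c}.encard ≤
      ((fun s₀ => d ≫ s₀) '' {s : Y ⟶ B | s ≫ b = t ≫ c}).encard := by
    rw [hinj.encard_image, hm, hm']
    exact_mod_cast le_csSup hbdd hmS
  have heq := Set.Finite.eq_of_subset_of_encard_le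
    ((Set.finite_of_encard_eq_coe hm').subset hsub) hsub hle
  have hmem : s ∈ {s : Z ⟶ B | s ≫ b = (d ≫ t) ≫ c} := hs
  rw [← heq] at hmem
  exact hmem

theorem exists_point_of_isPullback [F.Full] [F.Faithful] (hF : HasFormalSubsets F)
    (hE : EpiSurjective F) (hS : HasSpecializations F)
    {A B C P : 𝒞} {b : B ⟶ A} {c : C ⟶ A} {p : P ⟶ C} {q : P ⟶ B}
    (hfin : CFinite (F ⋙ Gen.space) b) (hdis : CDiscrete (F ⋙ Gen.space) b)
    (hopen : COpen (F ⋙ Gen.space) b) (hP : IsPullback p q c b)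
    (y : (F ⋙ Gen.space).obj C) (x : (F ⋙ Gen.space).obj B)
    (hxy : (F ⋙ Gen.space).map c y = (F ⋙ Gen.space).map b x) :
    ∃ z : (F ⋙ Gen.space).obj P, (F ⋙ Gen.space).map p z = y ∧ (F ⋙ Gen.space).map q z = x := by
  obtain ⟨Y, t, y₀, hy, hf, hmax⟩ := exists_maximal_lifts hF c hfin hdis y
  have key : ∃ s : Y ⟶ B, s ≫ b = t ≫ c ∧ (F ⋙ Gen.space).map s y₀ ⤳ x := by
    -- Otherwise each lift has a neighbourhood of `x` missing its value at `y₀`; the intersection of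
    -- these finitely many is open and contains the value of some lift, which descends to `Y`.
    by_contra! hcon
    have hcon' : ∀ s ∈ {s : Y ⟶ B | s ≫ b = t ≫ c}, ∃ O : Set ((F ⋙ Gen.space).obj B),
        IsOpen O ∧ x ∈ O ∧ (F ⋙ Gen.space).map s y₀ ∉ O := fun s hs => by
      simpa [specializes_iff_forall_open] using hcon s hs
    choose! O hO hxO hsO using hcon'
    obtain ⟨Z, d, s, z, hZ, hs, hz, hmem⟩ := exists_lift_mem hF hE hopen (t ≫ c) y₀ x
      (by rw [Functor.map_comp, ConcreteCategory.comp_apply, hy, hxy])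
      (hf.isOpen_biInter hO) (Set.mem_iInter₂.2 hxO)
    obtain ⟨s₀, hs₀, rfl⟩ := hmax Z d s z hZ (by rw [hs, Category.assoc]) hz
    rw [Functor.map_comp, ConcreteCategory.comp_apply, hz] at hmem
    exact hsO s₀ hs₀ (Set.mem_iInter₂.1 hmem s₀ hs₀)
  obtain ⟨s, hs, hsx⟩ := key
  obtain ⟨Z, s', t', z, hz, hz', hZ⟩ := hS Y B C s t y₀ x y hsx (hy ▸ specializes_rfl)
  have hw := hZ A b c hs hxy.symm
  refine ⟨(F ⋙ Gen.space).map (hP.lift t' s' hw.symm) z, ?_, ?_⟩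
  · rw [← ConcreteCategory.comp_apply, ← Functor.map_comp, hP.lift_fst, hz']
  · rw [← ConcreteCategory.comp_apply, ← Functor.map_comp, hP.lift_snd, hz]

end Points

/-! ### The three properties for `Gen` -/

section GenPoints

theorem Gen.hasFormalSubsets : HasFormalSubsets (𝟭 Gen.{u}) := by
  intro X (O : Set X.toTop) (hO : IsOpen O)
  have : LocallyConnectedSpace O := hO.isOpenEmbedding_subtypeVal.locallyConnectedSpace
  exact ⟨Gen.of O, Gen.ofHom (X := Gen.of O) (Subtype.val : O → X.toTop)
    hO.isOpenEmbedding_subtypeVal.isDiffuse, hO.isOpenEmbedding_subtypeVal, Subtype.range_val⟩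

theorem Gen.epiSurjective : EpiSurjective (𝟭 Gen.{u}) := by
  intro X Y f hf
  -- With the topology induced from `Y`, the `Prop` coordinate is indiscrete, so every subset of `Y`
  -- has a diffuse characteristic section.
  let r : Y.toTop × ULift.{u} Prop → Y.toTop := Prod.fst
  let τ : TopologicalSpace (Y.toTop × ULift.{u} Prop) := .induced r inferInstance
  have hr : IsInducing r := ⟨rfl⟩
  have : LocallyConnectedSpace (Y.toTop × ULift.{u} Prop) :=
    hr.locallyConnectedSpace_of_surjective Prod.fst_surjective
  let T : Gen.{u} := @Gen.of (Y.toTop × ULift.{u} Prop) τ this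
  let g (S : Set Y.toTop) : Y ⟶ T := Gen.ofHom (X := Y) (Y := T) (fun y => ((y, ⟨y ∈ S⟩) : Y.toTop × ULift.{u} Prop))
    (.of_leftInverse_isInducing hr fun _ => rfl)
  have h : g (Set.range (Gen.space.map f)) = g Set.univ := by
    rw [← cancel_epi f]
    refine Gen.hom_ext fun x => ?_
    have hx : Gen.space.map f x ∈ Set.range (Gen.space.map f) := ⟨x, rfl⟩
    exact Prod.ext rfl (ULift.ext _ _ (propext ⟨fun _ => trivial, fun _ => hx⟩))
  intro y
  have hy : ((y, ⟨y ∈ Set.range (Gen.space.map f)⟩) : Y.toTop × ULift.{u} Prop) =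
    (y, ⟨y ∈ Set.univ⟩) := congrArg (fun k => Gen.space.map k y) h
  have h2 := congrArg (fun z => z.2.down) hy
  exact h2.mpr trivial

theorem Gen.hasSpecializations : HasSpecializations (𝟭 Gen.{u}) := by
  intro Y B C s t (y : Y.toTop) b c hb hc
  refine ⟨Gen.of (AddSpecialization (X := Y.toTop) y),
    Gen.ofHom _ (AddSpecialization.isDiffuse_extend (Gen.isDiffuse_map s) hb),
    Gen.ofHom _ (AddSpecialization.isDiffuse_extend (Gen.isDiffuse_map t) hc),
    AddSpecialization.pt y, rfl, rfl, fun A f g h hbc => Gen.hom_ext fun z => ?_⟩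
  rcases AddSpecialization.cases (x₀ := y) z with rfl | ⟨x, rfl⟩
  · exact hbc
  · exact congrArg (fun k => Gen.space.map k x) h

end GenPoints

/-! ### The three properties for `HGen⁺` -/

section HGenPlusPoints

/-- The inclusion of `HGen⁺` in `Gen`. -/
abbrev HGenPlus.incl : HGenPlus.{u} ⥤ Gen.{u} :=
  ObjectProperty.ι (fun X : Gen.{u} => IsLocallyHausdorff X.toTop)

theorem HGenPlus.hasFormalSubsets : HasFormalSubsets HGenPlus.incl.{u} := by
  intro X O hO
  obtain ⟨U, i, hi, hr⟩ := Gen.hasFormalSubsets X.obj O hO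
  exact ⟨⟨U, X.property.of_injective hi.continuous hi.injective⟩, ObjectProperty.homMk i, hi, hr⟩

theorem HGenPlus.epiSurjective : EpiSurjective HGenPlus.incl.{u} := by
  intro X Y f hf (y : Y.obj.toTop)
  by_contra hy
  have : T1Space Y.obj.toTop := Y.property.t1Space
  let T : HGenPlus.{u} := ⟨Gen.of (DoublePoint (X := Y.obj.toTop) y), Y.property.doublePoint _⟩
  let g₁ : Y ⟶ T := ObjectProperty.homMk
    (Gen.ofHom (Y := T.obj) (DoublePoint.inl y) DoublePoint.isOpenEmbedding_inl.isDiffuse)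
  let g₂ : Y ⟶ T := ObjectProperty.homMk
    (Gen.ofHom (Y := T.obj) (DoublePoint.inr y) DoublePoint.isOpenEmbedding_inr.isDiffuse)
  -- The two copies differ only at `y`, which `f` misses.
  have h : g₁ = g₂ := by
    rw [← cancel_epi f]
    refine HGenPlus.incl.map_injective (Gen.hom_ext fun x => ?_)
    exact (DoublePoint.inr_of_ne fun hx => hy ⟨x, hx⟩).symm
  have h' : DoublePoint.inl y y = DoublePoint.inr y y :=
    congrArg (fun k => (HGenPlus.incl ⋙ Gen.space).map k y) h
  exact (DoublePoint.inl_eq_inr.1 h').2 rfl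

theorem HGenPlus.hasSpecializations : HasSpecializations HGenPlus.incl.{u} := by
  intro Y B C s t y b c hb hc
  have : T1Space ((HGenPlus.incl ⋙ Gen.space).obj B) := B.property.t1Space
  have : T1Space ((HGenPlus.incl ⋙ Gen.space).obj C) := C.property.t1Space
  -- In T1 spaces specializations are equalities, so `Y` itself serves.
  exact ⟨Y, s, t, y, hb.eq, hc.eq, fun _ _ _ h _ => h⟩

end HGenPlusPoints

theorem mainTheorem9 :
    (∀ (A B C P : Gen.{u}) (b : B ⟶ A) (c : C ⟶ A) (p : P ⟶ C) (q : P ⟶ B),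
      CFinite Gen.space b → CDiscrete Gen.space b → COpen Gen.space b →
      IsPullback p q c b →
      ∀ (y : Gen.space.obj C) (x : Gen.space.obj B),
        Gen.space.map c y = Gen.space.map b x →
        ∃ z : Gen.space.obj P, Gen.space.map p z = y ∧ Gen.space.map q z = x) ∧
    (∀ (A B C P : HGenPlus.{u}) (b : B ⟶ A) (c : C ⟶ A) (p : P ⟶ C) (q : P ⟶ B),
      CFinite HGenPlus.space b → CDiscrete HGenPlus.space b → COpen HGenPlus.space b →
      IsPullback p q c b →
      ∀ (y : HGenPlus.space.obj C) (x : HGenPlus.space.obj B),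
        HGenPlus.space.map c y = HGenPlus.space.map b x →
        ∃ z : HGenPlus.space.obj P,
          HGenPlus.space.map p z = y ∧ HGenPlus.space.map q z = x) := by
  exact ⟨fun _ _ _ _ _ _ _ _ hfin hdis hopen hP y x hxy =>
      exists_point_of_isPullback Gen.hasFormalSubsets Gen.epiSurjective Gen.hasSpecializations
        hfin hdis hopen hP y x hxy,
    fun _ _ _ _ _ _ _ _ hfin hdis hopen hP y x hxy =>
      exists_point_of_isPullback HGenPlus.hasFormalSubsets HGenPlus.epiSurjective
        HGenPlus.hasSpecializations hfin hdis hopen hP y x hxy⟩
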